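/- **Lemma 1.1.** Let $n,p\ge 1$, let $k$ be a field of characteristic $0$, $a\in k^n$, $x=(x_1,\dots,x_n)$, and let $f=(f_1,\dots,f_p)\in k[x]^p$ with all $f_j\neq 0$. Let $A$ be one of the rings $k[x]$, the localization $k[x]_a$ of $k[x]$ at the maximal ideal of $a$, the formal power series ring $k[[x-a]]$, or, if $k=\mathbb C$, the ring $\mathcal O_{\mathbb C^n,a}$ of germs at $a$ of complex analytic functions; regard $f_1,\dots,f_p$ as elements of $A$ and put $F=f_1\cdots f_p$. Let $D_A=A\langle\partial_{x_1},\dots,\partial_{x_n}\rangle$ be the ring of differential operators with coefficients in $A$, let $t=(t_1,\dots,t_p)$ be new variables, and let $D_A\langle t,\partial_t\rangle=D_A\otimes_k k[t]\langle\partial_t\rangle$, where $k[t]\langle\partial_t\rangle$ is the Weyl algebra in $t$. Let $s=(s_1,\dots,s_p)$ be indeterminates and let $D_A\langle t,\partial_t\rangle$ act on the free $A[1/F,s]$-module of rank one $\mathcal L_A=A[1/F,s]\cdot f^s$ as follows: $A$ acts by multiplication and, for $g=g(s)\in A[1/F,s]$, $$\partial_{x_i}\cdot g f^s=\Big(\frac{\partial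 g}{\partial x_i}+g\sum_{j=1}^p s_j\frac{\partial f_j}{\partial x_i}f_j^{-1}\Big)f^s,$$ $$t_j\cdot g(s)f^s=g(s_1,\dots,s_j+1,\dots,s_p)\,f_j f^s,\qquad \partial_{t_j}\cdot g(s)f^s=-s_j\,g(s_1,\dots,s_j-1,\dots,s_p)\,f_j^{-1}f^s .$$ Then, for each of these rings $A$, the annihilator $\{P\in D_A\langle t,\partial_t\rangle : P\cdot f^s=0\}$ is the left ideal of $D_A\langle t,\partial_t\rangle$ generated by the elements $$t_j-f_j\ \ (j=1,\dots,p),\qquad \partial_{x_i}+\sum_{j=1}^p\frac{\partial f_j}{\partial x_i}\,\partial_{t_j}\ \ (i=1,\dots,n).$$ -/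

import Mathlib

open Filter Topology
open scoped TensorProduct

namespace BernsteinSato

noncomputable section

/-! ### Rings with commuting derivations -/

/-- A family of pairwise commuting `k`-derivations of a commutative `k`-algebra `A`. -/
structure CommDeriv (k A ι : Type*) [CommRing k] [CommRing A] [Algebra k A] where
  d : ι → Derivation k A A
  comm : ∀ i j a, d i (d j a) = d j (d i a)

section Localization

variable {k A : Type*} [CommRing k] [CommRing A] [Algebra k A] (M : Submonoid A)

/-- The ring homomorphism `M⁻¹A → (M⁻¹A)[ε]/(ε²)` extending `a ↦ a + δ(a) ε`. -/
def dualLift (δ : Derivation k A A) :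
    Localization M →+* TrivSqZeroExt (Localization M) (Localization M) :=
  IsLocalization.lift (M := M)
    (g :=
      { toFun := fun a =>
          TrivSqZeroExt.inl (algebraMap A (Localization M) a) +
            TrivSqZeroExt.inr (algebraMap A (Localization M) (δ a))
        map_one' := by simp
        map_zero' := by simp
        map_add' := fun a b => by
          ext <;> simp [-DualNumber.inr_eq_smul_eps]
        map_mul' := fun a b => by
          ext <;> simp [-DualNumber.inr_eq_smul_eps, mul_comm] })
    (fun y => by
      rw [TrivSqZeroExt.isUnit_iff_isUnit_fst]
      simpa using IsLocalization.map_units (Localization M) y)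

theorem dualLift_algebraMap (δ : Derivation k A A) (a : A) :
    dualLift M δ (algebraMap A (Localization M) a) =
      TrivSqZeroExt.inl (algebraMap A (Localization M) a) +
            TrivSqZeroExt.inr (algebraMap A (Localization M) (δ a)) := by
  simp [dualLift]

theorem fst_dualLift (δ : Derivation k A A) (b : Localization M) :
    (dualLift M δ b).fst = b := by
  have : ((TrivSqZeroExt.fstHom (Localization M) (Localization M)
      (Localization M)).toRingHom.comp (dualLift M δ)) = RingHom.id _ := by
    apply IsLocalization.ringHom_ext M
    ext a
    simp [dualLift_algebraMap]
  exact RingHom.congr_fun this b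

/-- The unique extension of a derivation of `A` to the localization `M⁻¹A` (quotient rule). -/
def locDeriv (δ : Derivation k A A) : Derivation k (Localization M) (Localization M) :=
  Derivation.mk'
    { toFun := fun b => (dualLift M δ b).snd
      map_add' := fun a b => by simp
      map_smul' := fun r b => by
        have h : algebraMap k (Localization M) r
            = algebraMap A (Localization M) (algebraMap k A r) :=
          IsScalarTower.algebraMap_apply k A _ r
        simp [Algebra.smul_def, h, dualLift_algebraMap, fst_dualLift] }
    (fun a b => by
      simp [fst_dualLift, mul_comm])

theorem locDeriv_algebraMap (δ : Derivation k A A) (a : A) :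
    locDeriv M δ (algebraMap A (Localization M) a) = algebraMap A (Localization M) (δ a) := by
  simp [-DualNumber.inr_eq_smul_eps, locDeriv, dualLift_algebraMap]

theorem derivation_loc_ext {D E : Derivation k (Localization M) (Localization M)}
    (h : ∀ a, D (algebraMap A (Localization M) a) = E (algebraMap A (Localization M) a)) :
    D = E := by
  ext b
  obtain ⟨⟨a, s⟩, hb⟩ := IsLocalization.surj M b
  have hu := IsLocalization.map_units (Localization M) s
  have h1 := congrArg D hb
  have h2 := congrArg E hb
  simp only [Derivation.leibniz, h] at h1 h2
  have h3 := h1.trans h2.symm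
  rw [add_right_inj, smul_eq_mul, smul_eq_mul] at h3
  exact hu.mul_left_cancel h3

/-- Commuting derivations extend to commuting derivations of a localization. -/
def CommDeriv.localize {ι : Type*} (δ : CommDeriv k A ι) : CommDeriv k (Localization M) ι where
  d i := locDeriv M (δ.d i)
  comm i j b := by
    have h : ⁅locDeriv M (δ.d i), locDeriv M (δ.d j)⁆ = 0 := by
      apply derivation_loc_ext
      intro a
      simp [Derivation.commutator_apply, locDeriv_algebraMap, δ.comm i j a]
    have := DFunLike.congr_fun h b
    rw [Derivation.commutator_apply] at this
    exact sub_eq_zero.mp this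

end Localization

/-! ### The rings of differential operators -/

section DiffOp

variable {k A ι : Type*} [CommRing k] [CommRing A] [Algebra k A]

/-- The defining relations of `D_A = A⟨∂_i : i ∈ ι⟩`: the elements of `A` form a `k`-subalgebra,
`∂_i a = a ∂_i + δ_i(a)`, and the `∂_i` commute. -/
inductive DiffOp.Rel (δ : CommDeriv k A ι) :
    FreeAlgebra k (A ⊕ ι) → FreeAlgebra k (A ⊕ ι) → Prop
  | scalar (r : k) : DiffOp.Rel δ (FreeAlgebra.ι k (Sum.inl (algebraMap k A r)))
      (algebraMap k _ r)
  | add (a b : A) : DiffOp.Rel δ (FreeAlgebra.ι k (Sum.inl (a + b)))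
      (FreeAlgebra.ι k (Sum.inl a) + FreeAlgebra.ι k (Sum.inl b))
  | mul (a b : A) : DiffOp.Rel δ (FreeAlgebra.ι k (Sum.inl (a * b)))
      (FreeAlgebra.ι k (Sum.inl a) * FreeAlgebra.ι k (Sum.inl b))
  | leibniz (i : ι) (a : A) : DiffOp.Rel δ
      (FreeAlgebra.ι k (Sum.inr i) * FreeAlgebra.ι k (Sum.inl a))
      (FreeAlgebra.ι k (Sum.inl a) * FreeAlgebra.ι k (Sum.inr i)
        + FreeAlgebra.ι k (Sum.inl (δ.d i a)))
  | comm (i j : ι) : DiffOp.Rel δ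
      (FreeAlgebra.ι k (Sum.inr i) * FreeAlgebra.ι k (Sum.inr j))
      (FreeAlgebra.ι k (Sum.inr j) * FreeAlgebra.ι k (Sum.inr i))

/-- The ring `D_A = A⟨∂_i : i ∈ ι⟩` of differential operators with coefficients in `A`. -/
abbrev DiffOp (δ : CommDeriv k A ι) : Type _ := RingQuot (DiffOp.Rel δ)

/-- An element of `A` as an operator of order `0`. -/
def DiffOp.coef (δ : CommDeriv k A ι) (a : A) : DiffOp δ :=
  RingQuot.mkAlgHom k (DiffOp.Rel δ) (FreeAlgebra.ι k (Sum.inl a))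

/-- The operator `∂_i`. -/
def DiffOp.del (δ : CommDeriv k A ι) (i : ι) : DiffOp δ :=
  RingQuot.mkAlgHom k (DiffOp.Rel δ) (FreeAlgebra.ι k (Sum.inr i))

end DiffOp

section Weyl

variable (k : Type*) [CommRing k] (p : ℕ)

/-- The defining relations of the Weyl algebra `k[t]⟨∂_t⟩`; `Sum.inl j` is `t_j` and
`Sum.inr j` is `∂_{t_j}`. -/
inductive Weyl.Rel : FreeAlgebra k (Fin p ⊕ Fin p) → FreeAlgebra k (Fin p ⊕ Fin p) → Prop
  | tt (i j : Fin p) : Weyl.Rel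
      (FreeAlgebra.ι k (Sum.inl i) * FreeAlgebra.ι k (Sum.inl j))
      (FreeAlgebra.ι k (Sum.inl j) * FreeAlgebra.ι k (Sum.inl i))
  | dd (i j : Fin p) : Weyl.Rel
      (FreeAlgebra.ι k (Sum.inr i) * FreeAlgebra.ι k (Sum.inr j))
      (FreeAlgebra.ι k (Sum.inr j) * FreeAlgebra.ι k (Sum.inr i))
  | dt (i j : Fin p) : Weyl.Rel
      (FreeAlgebra.ι k (Sum.inr i) * FreeAlgebra.ι k (Sum.inl j))
      (FreeAlgebra.ι k (Sum.inl j) * FreeAlgebra.ι k (Sum.inr i) + if i = j then 1 else 0)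

/-- The Weyl algebra `k[t]⟨∂_t⟩` in `t = (t_1, …, t_p)`. -/
abbrev Weyl : Type _ := RingQuot (Weyl.Rel k p)

/-- The variable `t_j`. -/
def Weyl.t (j : Fin p) : Weyl k p :=
  RingQuot.mkAlgHom k (Weyl.Rel k p) (FreeAlgebra.ι k (Sum.inl j))

/-- The derivation `∂_{t_j}`. -/
def Weyl.dt (j : Fin p) : Weyl k p :=
  RingQuot.mkAlgHom k (Weyl.Rel k p) (FreeAlgebra.ι k (Sum.inr j))

end Weyl

/-- `D_A⟨t, ∂_t⟩ = D_A ⊗_k k[t]⟨∂_t⟩`. -/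
abbrev DiffOpT {k A ι : Type*} [CommRing k] [CommRing A] [Algebra k A]
    (δ : CommDeriv k A ι) (p : ℕ) : Type _ := DiffOp δ ⊗[k] Weyl k p

/-! ### The module `A[1/F, s] · f^s` -/

section Module

variable {k A ι : Type*} [CommRing k] [CommRing A] [Algebra k A] {p : ℕ}

/-- `A[1/F]` with `F = f_1 ⋯ f_p`. -/
abbrev InvF (f : Fin p → A) : Type _ := Localization (Submonoid.powers (∏ j, f j))

/-- `L_A = A[1/F, s] · f^s`: the polynomial `g(s)` stands for `g(s) f^s`, so `f^s` is `1`. -/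
abbrev LMod (f : Fin p → A) : Type _ := MvPolynomial (Fin p) (InvF f)

/-- The element `f_j⁻¹` of `A[1/F]`. -/
def finv (f : Fin p → A) (j : Fin p) : InvF f := Ring.inverse (algebraMap A (InvF f) (f j))

theorem mul_finv (f : Fin p → A) (j : Fin p) :
    algebraMap A (InvF f) (f j) * finv f j = 1 := by
  apply Ring.mul_inverse_cancel
  have h : IsUnit (algebraMap A (InvF f) (∏ j, f j)) :=
    IsLocalization.map_units (InvF f)
      (⟨_, Submonoid.mem_powers _⟩ : Submonoid.powers (∏ j, f j))
  exact isUnit_of_dvd_unit (map_dvd _ (Finset.dvd_prod_of_mem f (Finset.mem_univ j))) h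

/-- A derivation of `B` applied to the coefficients of a polynomial with coefficients in `B`. -/
def coeffFun {k B : Type*} [CommRing k] [CommRing B] [Algebra k B] {σ : Type*}
    (d : Derivation k B B) (g : MvPolynomial σ B) : MvPolynomial σ B :=
  ∑ m ∈ g.support, MvPolynomial.monomial m (d (g.coeff m))

theorem coeff_coeffFun {k B : Type*} [CommRing k] [CommRing B] [Algebra k B] {σ : Type*}
    (d : Derivation k B B) (g : MvPolynomial σ B) (m : σ →₀ ℕ) :
    (coeffFun d g).coeff m = d (g.coeff m) := by
  classical
  simp only [coeffFun, MvPolynomial.coeff_sum, MvPolynomial.coeff_monomial,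
    Finset.sum_ite_eq']
  split_ifs with h
  · rfl
  · rw [MvPolynomial.notMem_support_iff.mp h, map_zero]

/-- The derivation of `B[s]` that extends the derivation `d` of `B` and kills the variables. -/
def coeffDeriv {k B : Type*} [CommRing k] [CommRing B] [Algebra k B] {σ : Type*}
    (d : Derivation k B B) : Derivation k (MvPolynomial σ B) (MvPolynomial σ B) :=
  Derivation.mk'
    { toFun := coeffFun d
      map_add' := fun a b => by
        ext m; simp [coeff_coeffFun]
      map_smul' := fun r a => by
        ext m; simp [coeff_coeffFun] }
    (fun a b => by
      classical
      ext m
      simp only [LinearMap.coe_mk, AddHom.coe_mk, coeff_coeffFun, smul_eq_mul,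
        MvPolynomial.coeff_add, MvPolynomial.coeff_mul, map_sum, Derivation.leibniz,
        Finset.sum_add_distrib]
      congr 1
      refine Finset.sum_nbij' Prod.swap Prod.swap ?_ ?_ ?_ ?_ ?_ <;>
        simp [add_comm])

section coeffDeriv

variable {B σ : Type*} [CommRing B] [Algebra k B]

@[simp] theorem coeff_coeffDeriv (d : Derivation k B B) (g : MvPolynomial σ B) (m : σ →₀ ℕ) :
    (coeffDeriv d g).coeff m = d (g.coeff m) := coeff_coeffFun d g m

@[simp] theorem coeffDeriv_C (d : Derivation k B B) (b : B) :
    coeffDeriv d (MvPolynomial.C b : MvPolynomial σ B) = MvPolynomial.C (d b) := by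
  classical
  ext m
  simp only [coeff_coeffDeriv, MvPolynomial.coeff_C]
  split_ifs <;> simp

@[simp] theorem coeffDeriv_X (d : Derivation k B B) (i : σ) :
    coeffDeriv d (MvPolynomial.X i : MvPolynomial σ B) = 0 := by
  classical
  ext m
  simp only [coeff_coeffDeriv, MvPolynomial.coeff_X, MvPolynomial.coeff_zero]
  split_ifs <;> simp

end coeffDeriv

/-- The substitution `s_j ↦ s_j + c` (the other variables are fixed). -/
def shift {B : Type*} [CommRing B] (j : Fin p) (c : ℤ) :
    MvPolynomial (Fin p) B →ₐ[B] MvPolynomial (Fin p) B :=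
  MvPolynomial.aeval fun l => MvPolynomial.X l + if l = j then (c : MvPolynomial (Fin p) B) else 0

section shift

variable {B : Type*} [CommRing B]

theorem shift_X (j : Fin p) (c : ℤ) (l : Fin p) :
    shift j c (MvPolynomial.X l : MvPolynomial (Fin p) B) =
      MvPolynomial.X l + if l = j then (c : MvPolynomial (Fin p) B) else 0 := by
  simp [shift]

@[simp] theorem shift_C (j : Fin p) (c : ℤ) (b : B) :
    shift j c (MvPolynomial.C b : MvPolynomial (Fin p) B) = MvPolynomial.C b := by
  simp [shift]

theorem shift_comm (i j : Fin p) (c e : ℤ) (g : MvPolynomial (Fin p) B) :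
    shift i c (shift j e g) = shift j e (shift i c g) := by
  have h : (shift (B := B) i c).comp (shift j e) = (shift j e).comp (shift i c) := by
    ext l : 1
    simp only [AlgHom.comp_apply, shift_X, map_add]
    split_ifs <;> simp [add_right_comm]
  exact DFunLike.congr_fun h g

theorem shift_shift_neg (j : Fin p) (c : ℤ) (g : MvPolynomial (Fin p) B) :
    shift j c (shift j (-c) g) = g := by
  have h : (shift (B := B) j c).comp (shift j (-c)) = AlgHom.id _ _ := by
    ext l : 1
    simp only [AlgHom.comp_apply, shift_X, map_add]
    split_ifs <;> simp
  exact DFunLike.congr_fun h g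

theorem coeffDeriv_shift [Algebra k B] (d : Derivation k B B) (j : Fin p) (c : ℤ)
    (g : MvPolynomial (Fin p) B) :
    coeffDeriv d (shift j c g) = shift j c (coeffDeriv d g) := by
  induction g using MvPolynomial.induction_on with
  | C a => simp
  | add a b ha hb => simp [ha, hb]
  | mul_X a l ha =>
    have hz : coeffDeriv d (shift j c (MvPolynomial.X l : MvPolynomial (Fin p) B)) = 0 := by
      rw [shift_X]
      split_ifs <;> simp
    simp [Derivation.leibniz, ha, hz]

end shift

open MvPolynomial in
/-- The logarithmic derivative `∑_j s_j ∂_i(f_j) / f_j`. -/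
def logDer (δ : CommDeriv k A ι) (f : Fin p → A) (i : ι) : LMod f :=
  ∑ j, X j * C (algebraMap A (InvF f) (δ.d i (f j)) * finv f j)

/-- `a · (g f^s) = (a g) f^s`. -/
def opCoef (k : Type*) [CommRing k] [Algebra k A] (f : Fin p → A) (a : A) :
    Module.End k (LMod f) :=
  LinearMap.mulLeft k (MvPolynomial.C (algebraMap A (InvF f) a))

/-- `∂_i · (g f^s) = (∂_i g + g ∑_j s_j ∂_i(f_j) / f_j) f^s`. -/
def opDel (δ : CommDeriv k A ι) (f : Fin p → A) (i : ι) : Module.End k (LMod f) :=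
  (coeffDeriv ((δ.localize (Submonoid.powers (∏ j, f j))).d i)).toLinearMap +
    LinearMap.mulRight k (logDer δ f i)

/-- `t_j · (g(s) f^s) = g(s_1, …, s_j + 1, …, s_p) f_j f^s`. -/
def opT (k : Type*) [CommRing k] [Algebra k A] (f : Fin p → A) (j : Fin p) :
    Module.End k (LMod f) :=
  LinearMap.mulRight k (MvPolynomial.C (algebraMap A (InvF f) (f j))) ∘ₗ
    ((shift j 1).restrictScalars k).toLinearMap

/-- `∂_{t_j} · (g(s) f^s) = - s_j g(s_1, …, s_j - 1, …, s_p) f_j⁻¹ f^s`. -/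
def opDt (k : Type*) [CommRing k] [Algebra k A] (f : Fin p → A) (j : Fin p) :
    Module.End k (LMod f) :=
  - (LinearMap.mulLeft k (MvPolynomial.X j) ∘ₗ
    LinearMap.mulRight k (MvPolynomial.C (finv f j)) ∘ₗ
    ((shift j (-1)).restrictScalars k).toLinearMap)

section apply

variable (δ : CommDeriv k A ι) (f : Fin p → A)

theorem opCoef_apply (a : A) (g : LMod f) :
    opCoef k f a g = MvPolynomial.C (algebraMap A (InvF f) a) * g := rfl

theorem opDel_apply (i : ι) (g : LMod f) :
    opDel δ f i g = coeffDeriv (locDeriv (Submonoid.powers (∏ j, f j)) (δ.d i)) g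
      + g * logDer δ f i := rfl

theorem opT_apply (j : Fin p) (g : LMod f) :
    opT k f j g = shift j 1 g * MvPolynomial.C (algebraMap A (InvF f) (f j)) := rfl

theorem opDt_apply (j : Fin p) (g : LMod f) :
    opDt k f j g = - (MvPolynomial.X j * (shift j (-1) g * MvPolynomial.C (finv f j))) := rfl

/-- Derivative of `f_j⁻¹`. -/
theorem locDeriv_finv (d : Derivation k A A) (j : Fin p) :
    locDeriv (Submonoid.powers (∏ j, f j)) d (finv f j) =
      - (finv f j) ^ 2 * algebraMap A (InvF f) (d (f j)) := by
  have := Derivation.leibniz_of_mul_eq_one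
    (locDeriv (Submonoid.powers (∏ j, f j)) d) (a := finv f j)
    (b := algebraMap A (InvF f) (f j)) (by rw [mul_comm, mul_finv])
  rw [this, locDeriv_algebraMap, smul_eq_mul]

/-- The logarithmic derivatives form a closed form. -/
theorem coeffDeriv_logDer (i j : ι) :
    coeffDeriv (locDeriv (Submonoid.powers (∏ j, f j)) (δ.d i)) (logDer δ f j) =
      coeffDeriv (locDeriv (Submonoid.powers (∏ j, f j)) (δ.d j)) (logDer δ f i) := by
  simp only [logDer, map_sum]
  refine Finset.sum_congr rfl fun l _ => ?_
  simp only [Derivation.leibniz, coeffDeriv_X, coeffDeriv_C, mul_zero, add_zero,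
    locDeriv_algebraMap, locDeriv_finv, smul_eq_mul]
  rw [δ.comm i j]
  congr 2
  ring

theorem shift_logDer (i : ι) (j : Fin p) (c : ℤ) :
    shift j c (logDer δ f i) = logDer δ f i +
      (c : LMod f) * MvPolynomial.C (algebraMap A (InvF f) (δ.d i (f j)) * finv f j) := by
  simp only [logDer, map_sum, map_mul, shift_X, shift_C, add_mul, Finset.sum_add_distrib]
  congr 1
  rw [Finset.sum_eq_single j]
  · simp
  · intro b _ hb
    simp [hb]
  · simp

end apply

/-- The action of `D_A` on `L_A`. -/
def actD (δ : CommDeriv k A ι) (f : Fin p → A) : DiffOp δ →ₐ[k] Module.End k (LMod f) :=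
  RingQuot.liftAlgHom k
    ⟨FreeAlgebra.lift k (Sum.elim (opCoef k f) (opDel δ f)), by
      intro x y h
      induction h with
      | scalar r =>
        refine LinearMap.ext fun g => ?_
        have h : algebraMap A (InvF f) (algebraMap k A r) = algebraMap k (InvF f) r :=
          (IsScalarTower.algebraMap_apply k A _ r).symm
        simp [opCoef_apply, h, Algebra.smul_def, MvPolynomial.algebraMap_apply]
      | add a b =>
        refine LinearMap.ext fun g => ?_
        simp [opCoef_apply, add_mul]
      | mul a b =>
        refine LinearMap.ext fun g => ?_
        simp [opCoef_apply, mul_assoc]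
      | leibniz i a =>
        refine LinearMap.ext fun g => ?_
        simp only [map_mul, map_add, FreeAlgebra.lift_ι_apply, Sum.elim_inl, Sum.elim_inr,
          Module.End.mul_apply, LinearMap.add_apply, opCoef_apply, opDel_apply,
          Derivation.leibniz, coeffDeriv_C, locDeriv_algebraMap, smul_eq_mul]
        ring
      | comm i j =>
        refine LinearMap.ext fun g => ?_
        have h := coeffDeriv_logDer δ f i j
        have h2 : coeffDeriv (locDeriv (Submonoid.powers (∏ j, f j)) (δ.d i))
            (coeffDeriv (locDeriv (Submonoid.powers (∏ j, f j)) (δ.d j)) g) =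
            coeffDeriv (locDeriv (Submonoid.powers (∏ j, f j)) (δ.d j))
            (coeffDeriv (locDeriv (Submonoid.powers (∏ j, f j)) (δ.d i)) g) := by
          ext m
          simp only [coeff_coeffDeriv]
          exact (δ.localize (Submonoid.powers (∏ j, f j))).comm i j _
        simp only [map_mul, FreeAlgebra.lift_ι_apply, Sum.elim_inr,
          Module.End.mul_apply, opDel_apply, map_add, Derivation.leibniz, smul_eq_mul, h, h2]
        ring⟩

/-- The action of the Weyl algebra `k[t]⟨∂_t⟩` on `L_A`. -/
def actW (k : Type*) [CommRing k] [Algebra k A] (f : Fin p → A) :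
    Weyl k p →ₐ[k] Module.End k (LMod f) :=
  RingQuot.liftAlgHom k
    ⟨FreeAlgebra.lift k (Sum.elim (opT k f) (opDt k f)), by
      intro x y h
      induction h with
      | tt i j =>
        refine LinearMap.ext fun g => ?_
        simp only [map_mul, FreeAlgebra.lift_ι_apply, Sum.elim_inl, Module.End.mul_apply,
          opT_apply, shift_C, shift_comm i j]
        ring
      | dd i j =>
        refine LinearMap.ext fun g => ?_
        by_cases hij : i = j
        · subst hij; rfl
        simp only [map_mul, map_neg, FreeAlgebra.lift_ι_apply, Sum.elim_inr,
          Module.End.mul_apply, opDt_apply, shift_C, shift_X, shift_comm i j, if_neg hij,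
          if_neg (Ne.symm hij)]
        ring
      | dt i j =>
        refine LinearMap.ext fun g => ?_
        by_cases hij : i = j
        · subst hij
          have h1 := shift_shift_neg i 1 g
          have h2 := shift_shift_neg i (-1) g
          rw [neg_neg] at h2
          have h3 : (MvPolynomial.C (algebraMap A (InvF f) (f i)) : LMod f) *
              MvPolynomial.C (finv f i) = 1 := by
            rw [← map_mul, mul_finv, map_one]
          simp only [map_mul, map_neg, map_add, map_one, FreeAlgebra.lift_ι_apply, Sum.elim_inr,
            Sum.elim_inl, Module.End.mul_apply, LinearMap.add_apply, opDt_apply, opT_apply,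
            shift_C, shift_X, h1, h2, if_true, Module.End.one_apply, Int.cast_one]
          linear_combination (g) * h3
        · simp only [map_mul, map_neg, add_zero, FreeAlgebra.lift_ι_apply,
            Sum.elim_inr, Sum.elim_inl, Module.End.mul_apply, opDt_apply,
            opT_apply, shift_C, shift_X, if_neg hij, shift_comm i j]
          ring⟩

theorem actD_coef (δ : CommDeriv k A ι) (f : Fin p → A) (a : A) :
    actD δ f (DiffOp.coef δ a) = opCoef k f a := by
  simp [actD, DiffOp.coef]

theorem actD_del (δ : CommDeriv k A ι) (f : Fin p → A) (i : ι) :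
    actD δ f (DiffOp.del δ i) = opDel δ f i := by
  simp [actD, DiffOp.del]

theorem actW_t (f : Fin p → A) (j : Fin p) : actW k f (Weyl.t k p j) = opT k f j := by
  simp [actW, Weyl.t]

theorem actW_dt (f : Fin p → A) (j : Fin p) : actW k f (Weyl.dt k p j) = opDt k f j := by
  simp [actW, Weyl.dt]

/-- To lie in a subalgebra it suffices to do so on the generators of a presented algebra. -/
theorem lift_mem {X E : Type*} [Ring E] [Algebra k E]
    {r : FreeAlgebra k X → FreeAlgebra k X → Prop} (φ : RingQuot r →ₐ[k] E) (S : Subalgebra k E)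
    (h : ∀ x, φ (RingQuot.mkAlgHom k r (FreeAlgebra.ι k x)) ∈ S) (z : RingQuot r) : φ z ∈ S := by
  obtain ⟨w, rfl⟩ := RingQuot.mkAlgHom_surjective k r z
  induction w using FreeAlgebra.induction with
  | grade0 c => simp
  | grade1 x => exact h x
  | mul a b ha hb => rw [map_mul, map_mul]; exact S.mul_mem ha hb
  | add a b ha hb => rw [map_add, map_add]; exact S.add_mem ha hb

theorem op_commute (δ : CommDeriv k A ι) (f : Fin p → A) (x : A ⊕ ι) (y : Fin p ⊕ Fin p) :
    Commute (Sum.elim (opCoef k f) (opDel δ f) x) (Sum.elim (opT k f) (opDt k f) y) := by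
  rcases x with a | i <;> rcases y with j | j
  · refine LinearMap.ext fun g => ?_
    simp only [Sum.elim_inl, Module.End.mul_apply, opCoef_apply, opT_apply, map_mul, shift_C]
    ring
  · refine LinearMap.ext fun g => ?_
    simp only [Sum.elim_inl, Sum.elim_inr, Module.End.mul_apply, opCoef_apply, opDt_apply,
      map_mul, shift_C]
    ring
  · refine LinearMap.ext fun g => ?_
    have h3 : (MvPolynomial.C (algebraMap A (InvF f) (f j)) : LMod f) *
        MvPolynomial.C (finv f j) = 1 := by
      rw [← map_mul, mul_finv, map_one]
    simp only [Sum.elim_inl, Sum.elim_inr, Module.End.mul_apply, opDel_apply, opT_apply,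
      map_add, map_mul, Derivation.leibniz, coeffDeriv_C, coeffDeriv_shift, shift_logDer,
      locDeriv_algebraMap, smul_eq_mul, Int.cast_one]
    linear_combination (- shift j 1 g * MvPolynomial.C (algebraMap A (InvF f) (δ.d i (f j)))) * h3
  · refine LinearMap.ext fun g => ?_
    simp only [Sum.elim_inr, Module.End.mul_apply, opDel_apply, opDt_apply,
      map_add, map_mul, map_neg, Derivation.leibniz, coeffDeriv_C, coeffDeriv_X, coeffDeriv_shift,
      shift_logDer, locDeriv_finv, smul_eq_mul, Int.cast_neg, Int.cast_one, map_pow]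
    ring

theorem act_commute (δ : CommDeriv k A ι) (f : Fin p → A) (x : DiffOp δ) (y : Weyl k p) :
    Commute (actD δ f x) (actW k f y) := by
  have h := lift_mem (actD δ f) (Subalgebra.centralizer k (Set.range (actW k f))) ?_ x
  · exact ((Subalgebra.mem_centralizer_iff k).mp h _ ⟨y, rfl⟩).symm
  intro u
  rw [Subalgebra.mem_centralizer_iff]
  rintro _ ⟨y, rfl⟩
  have h' := lift_mem (actW k f) (Subalgebra.centralizer k
    {actD δ f (RingQuot.mkAlgHom k _ (FreeAlgebra.ι k u))}) ?_ y
  · exact ((Subalgebra.mem_centralizer_iff k).mp h' _ rfl).symm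
  intro v
  rw [Subalgebra.mem_centralizer_iff]
  rintro _ rfl
  have := op_commute δ f u v
  simpa [actD, actW] using this.eq

/-- The action of `D_A⟨t, ∂_t⟩` on `L_A = A[1/F, s] · f^s`. -/
def act (δ : CommDeriv k A ι) (f : Fin p → A) : DiffOpT δ p →ₐ[k] Module.End k (LMod f) :=
  Algebra.TensorProduct.lift (actD δ f) (actW k f) (act_commute δ f)

/-- The element `f^s` of `L_A`. -/
def fs (f : Fin p → A) : LMod f := 1

/-- The annihilator of `f^s` in `D_A⟨t, ∂_t⟩`, a left ideal. -/
def annFs (δ : CommDeriv k A ι) (f : Fin p → A) : Ideal (DiffOpT δ p) where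
  carrier := {P | act δ f P (fs f) = 0}
  add_mem' := fun {P Q} hP hQ => by
    simp only [Set.mem_ofPred_eq] at hP hQ ⊢
    rw [map_add, LinearMap.add_apply, hP, hQ, add_zero]
  zero_mem' := by simp
  smul_mem' := fun R P hP => by
    simp only [Set.mem_ofPred_eq] at hP ⊢
    rw [smul_eq_mul, map_mul, Module.End.mul_apply, hP, map_zero]

/-- The elements `t_j - f_j` and `∂_{x_i} + ∑_j ∂_{x_i}(f_j) ∂_{t_j}` of `D_A⟨t, ∂_t⟩`. -/
def malgrangeGens (δ : CommDeriv k A ι) (f : Fin p → A) : Set (DiffOpT δ p) :=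
  Set.range (fun j : Fin p => (1 ⊗ₜ[k] Weyl.t k p j - DiffOp.coef δ (f j) ⊗ₜ[k] 1 : DiffOpT δ p)) ∪
  Set.range (fun i : ι => (DiffOp.del δ i ⊗ₜ[k] 1 +
    ∑ j : Fin p, DiffOp.coef δ (δ.d i (f j)) ⊗ₜ[k] Weyl.dt k p j : DiffOpT δ p))

end Module

/-! ### The four coefficient rings -/

section Rings

variable (k : Type*) [Field k] {n : ℕ}

/-- `k[x]` with `∂_{x_1}, …, ∂_{x_n}`. -/
def polyDeriv (n : ℕ) : CommDeriv k (MvPolynomial (Fin n) k) (Fin n) where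
  d i := MvPolynomial.pderiv i
  comm i j a := by
    let D : Fin n → Derivation k (MvPolynomial (Fin n) k) (MvPolynomial (Fin n) k) :=
      fun i => MvPolynomial.pderiv i
    have h : ⁅D i, D j⁆ = 0 := by
      apply MvPolynomial.derivation_ext
      intro l
      rw [Derivation.commutator_apply]
      simp [D, MvPolynomial.pderiv_X, Pi.single_apply, apply_ite]
    have := DFunLike.congr_fun h a
    rw [Derivation.commutator_apply] at this
    exact sub_eq_zero.mp this

variable {k}

/-- The maximal ideal of `k[x]` of the polynomials that vanish at `a`. -/
def maxIdealAt (a : Fin n → k) : Ideal (MvPolynomial (Fin n) k) :=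
  RingHom.ker (MvPolynomial.eval a)

instance (a : Fin n → k) : (maxIdealAt a).IsPrime := RingHom.ker_isPrime _

/-- The local ring `k[x]_a`. -/
abbrev LocalRingAt (a : Fin n → k) : Type _ := Localization.AtPrime (maxIdealAt a)

/-- `k[x]_a` with `∂_{x_1}, …, ∂_{x_n}`. -/
def localDeriv (a : Fin n → k) : CommDeriv k (LocalRingAt a) (Fin n) :=
  (polyDeriv k n).localize (maxIdealAt a).primeCompl

/-- `k[[x - a]]` with `∂_{x_1}, …, ∂_{x_n}`; the `i`-th variable of the power series ring
stands for `x_i - a_i`. -/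
def formalDeriv (k : Type*) [Field k] (n : ℕ) :
    CommDeriv k (MvPowerSeries (Fin n) k) (Fin n) where
  d i := MvPowerSeries.pderiv k i
  comm i j g := by
    ext m
    simp only [MvPowerSeries.coeff_pderiv, Finsupp.add_apply]
    rw [add_right_comm]
    by_cases h : i = j
    · subst h; rfl
    · simp [h, Ne.symm h]
      ring

/-- The expansion at `a` of a polynomial: the inclusion `k[x] ⊆ k[[x - a]]`. -/
def expandAt (a : Fin n → k) : MvPolynomial (Fin n) k →ₐ[k] MvPowerSeries (Fin n) k :=
  MvPolynomial.aeval fun i => MvPowerSeries.X i + MvPowerSeries.C (a i)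

end Rings

section Analytic

variable {n : ℕ}

instance germAlgebra (a : Fin n → ℂ) : Algebra ℂ (Germ (𝓝 a) ℂ) :=
  Algebra.ofModule
    (fun r x y => by
      induction x using Filter.Germ.inductionOn
      induction y using Filter.Germ.inductionOn
      rw [← Germ.coe_smul, ← Germ.coe_mul, ← Germ.coe_mul, ← Germ.coe_smul, smul_mul_assoc])
    (fun r x y => by
      induction x using Filter.Germ.inductionOn
      induction y using Filter.Germ.inductionOn
      rw [← Germ.coe_smul, ← Germ.coe_mul, ← Germ.coe_mul, ← Germ.coe_smul, mul_smul_comm])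

/-- The ring `𝒪_{ℂⁿ, a}` of germs at `a` of complex analytic functions. -/
def analyticGerms (a : Fin n → ℂ) : Subalgebra ℂ (Germ (𝓝 a) ℂ) where
  carrier := {g | ∃ h : (Fin n → ℂ) → ℂ, AnalyticAt ℂ h a ∧ g = (h : Germ (𝓝 a) ℂ)}
  mul_mem' := by
    rintro _ _ ⟨g, hg, rfl⟩ ⟨h, hh, rfl⟩
    exact ⟨g * h, hg.mul hh, rfl⟩
  add_mem' := by
    rintro _ _ ⟨g, hg, rfl⟩ ⟨h, hh, rfl⟩
    exact ⟨g + h, hg.add hh, rfl⟩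
  algebraMap_mem' := fun r => by
    refine ⟨fun _ => r, analyticAt_const, ?_⟩
    rw [Algebra.algebraMap_eq_smul_one]
    change (((r • (1 : (Fin n → ℂ) → ℂ)) : (Fin n → ℂ) → ℂ) : Germ (𝓝 a) ℂ) = _
    congr 1
    ext z
    simp

/-- The germ at `a` of `∂h/∂x_i`. -/
def germPartial (a : Fin n → ℂ) (i : Fin n) (g : Germ (𝓝 a) ℂ) : Germ (𝓝 a) ℂ :=
  Quotient.map' (fun (h : (Fin n → ℂ) → ℂ) (z : Fin n → ℂ) => fderiv ℂ h z (Pi.single i 1))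
    (fun h₁ h₂ (e : h₁ =ᶠ[𝓝 a] h₂) => by
      filter_upwards [e.fderiv (𝕜 := ℂ)] with z hz
      rw [hz]) g

theorem germPartial_coe (a : Fin n → ℂ) (i : Fin n) (h : (Fin n → ℂ) → ℂ) :
    germPartial a i (h : Germ (𝓝 a) ℂ) =
      ((fun z => fderiv ℂ h z (Pi.single i 1) : (Fin n → ℂ) → ℂ) : Germ (𝓝 a) ℂ) := rfl

theorem analyticAt_partial {a : Fin n → ℂ} {h : (Fin n → ℂ) → ℂ} (hh : AnalyticAt ℂ h a)
    (i : Fin n) : AnalyticAt ℂ (fun z => fderiv ℂ h z (Pi.single i 1)) a :=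
  ((ContinuousLinearMap.apply ℂ ℂ (Pi.single i 1 : Fin n → ℂ)).analyticAt _).comp hh.fderiv

/-- `∂_{x_i}` on germs of analytic functions. -/
def analyticPartial (a : Fin n → ℂ) (i : Fin n) :
    Derivation ℂ (analyticGerms a) (analyticGerms a) :=
  Derivation.mk'
    { toFun := fun g => ⟨germPartial a i g, by
        obtain ⟨_, h, hh, rfl⟩ := g
        exact ⟨_, analyticAt_partial hh i, germPartial_coe a i h⟩⟩
      map_add' := by
        rintro ⟨_, g, hg, rfl⟩ ⟨_, h, hh, rfl⟩
        apply Subtype.ext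
        apply Germ.coe_eq.mpr
        filter_upwards [hg.eventually_analyticAt, hh.eventually_analyticAt] with z h1 h2
        exact DFunLike.congr_fun (fderiv_add h1.differentiableAt h2.differentiableAt) _
      map_smul' := by
        rintro r ⟨_, g, hg, rfl⟩
        apply Subtype.ext
        apply Germ.coe_eq.mpr
        filter_upwards [hg.eventually_analyticAt] with z h1
        exact DFunLike.congr_fun (fderiv_const_smul h1.differentiableAt r) _ }
    (by
      rintro ⟨_, g, hg, rfl⟩ ⟨_, h, hh, rfl⟩
      apply Subtype.ext
      apply Germ.coe_eq.mpr
      filter_upwards [hg.eventually_analyticAt, hh.eventually_analyticAt] with z h1 h2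
      exact DFunLike.congr_fun (fderiv_mul h1.differentiableAt h2.differentiableAt) _)

/-- `𝒪_{ℂⁿ, a}` with `∂_{x_1}, …, ∂_{x_n}`. -/
def analyticDeriv (a : Fin n → ℂ) : CommDeriv ℂ (analyticGerms a) (Fin n) where
  d i := analyticPartial a i
  comm i j := by
    rintro ⟨_, g, hg, rfl⟩
    apply Subtype.ext
    apply Germ.coe_eq.mpr
    filter_upwards [hg.eventually_analyticAt] with z h1
    have hs : IsSymmSndFDerivAt ℂ g z := h1.contDiffAt.isSymmSndFDerivAt_of_omega
    have hd : DifferentiableAt ℂ (fderiv ℂ g) z := h1.fderiv.differentiableAt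
    have e : ∀ u v : Fin n → ℂ,
        fderiv ℂ (fun y => fderiv ℂ g y u) z v = fderiv ℂ (fderiv ℂ g) z v u := by
      intro u v
      rw [fderiv_clm_apply hd (differentiableAt_const _)]
      simp
    rw [e, e]
    exact hs _ _

/-- The germ at `a` of a polynomial function: the inclusion `ℂ[x] ⊆ 𝒪_{ℂⁿ, a}`. -/
def polyGerm (a : Fin n → ℂ) (q : MvPolynomial (Fin n) ℂ) : analyticGerms a :=
  ⟨((fun z => MvPolynomial.eval z q : (Fin n → ℂ) → ℂ) : Germ (𝓝 a) ℂ),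
    _, AnalyticOnNhd.eval_mvPolynomial q a trivial, rfl⟩

end Analytic

end

end BernsteinSato

/-! Let `I` be the left ideal generated by the stated elements. Modulo `I`, a `t_j` standing at the
right end of an operator may be replaced by `f_j`, and a `∂_{x_i}` by `-∑_j ∂_{x_i}(f_j) ∂_{t_j}`.
Hence every operator is congruent to a normal form `∑_m a_m ∂_t^m` with `a_m ∈ A`
(`reducible_eq_top`). Since `I` kills `f^s` (`span_malgrangeGens_le_annFs`), it remains to see that
a normal form killing `f^s` is zero.

The coefficient of `f^s` in `∂_t^m · f^s` is the product over `j` of `(-1)^{m_j} s_j (s_j - 1) ⋯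
(s_j - m_j + 1) f_j^{-m_j}`. At a point `s = r` with natural coordinates it vanishes unless `m ≤ r`,
and at `s = m` it is a unit of `A[1/F]` because the characteristic is zero. Evaluation at such
points is therefore a triangular system for the `a_m`, which forces them all to vanish
(`eq_zero_of_act_normalForm_eq_zero`).

The only property of `A` used, besides its commuting derivations, is that `F` is not a zero divisor,
which makes `A → A[1/F]` injective. The four rings are domains in which each `f_j` stays nonzero. -/

namespace BernsteinSato

/-- A submodule over a ring is closed under cancellation of a member. -/
theorem mem_of_add_mem {k M : Type*} [Ring k] [AddCommMonoid M] [Module k M] {N : Submodule k M}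
    {x y : M} (hy : y ∈ N) (h : x + y ∈ N) : x ∈ N := by
  have e : x = x + y + (-1 : k) • y := by
    rw [add_assoc]
    have h0 : (1 : k) • y + (-1 : k) • y = 0 := by rw [← add_smul, add_neg_cancel, zero_smul]
    rw [one_smul] at h0
    rw [h0, add_zero]
  rw [e]
  exact add_mem h (N.smul_mem _ hy)

/-- `lift_mem` for homomorphisms to a semiring. -/
theorem map_mem_of_generators {k X E : Type*} [CommRing k] [Semiring E] [Algebra k E]
    {r : FreeAlgebra k X → FreeAlgebra k X → Prop} (φ : RingQuot r →ₐ[k] E) (S : Subalgebra k E)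
    (h : ∀ x, φ (RingQuot.mkAlgHom k r (FreeAlgebra.ι k x)) ∈ S) (z : RingQuot r) : φ z ∈ S := by
  obtain ⟨w, rfl⟩ := RingQuot.mkAlgHom_surjective k r z
  induction w using FreeAlgebra.induction with
  | grade0 c => simp
  | grade1 x => exact h x
  | mul a b ha hb => rw [map_mul, map_mul]; exact S.mul_mem ha hb
  | add a b ha hb => rw [map_add, map_add]; exact S.add_mem ha hb

/-! ### Normal forms modulo the left ideal -/

section NormalForm

variable {k A ι : Type*} [CommRing k] [CommRing A] [Algebra k A]

/-- The inclusion of `A` into `D_A`. -/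
noncomputable def DiffOp.coefHom (δ : CommDeriv k A ι) : A →ₐ[k] DiffOp δ :=
  AlgHom.ofLinearMap
    { toFun := DiffOp.coef δ
      map_add' := fun a b => by
        simpa [DiffOp.coef] using RingQuot.mkAlgHom_rel k (DiffOp.Rel.add (δ := δ) a b)
      map_smul' := fun r a => by
        have h := RingQuot.mkAlgHom_rel k (DiffOp.Rel.mul (δ := δ) (algebraMap k A r) a)
        have h' := RingQuot.mkAlgHom_rel k (DiffOp.Rel.scalar (δ := δ) r)
        rw [map_mul, h', AlgHom.commutes] at h
        simpa [DiffOp.coef, Algebra.smul_def] using h }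
    (by
      have h := RingQuot.mkAlgHom_rel k (DiffOp.Rel.scalar (δ := δ) 1)
      simpa [DiffOp.coef] using h)
    (fun a b => by
      simpa [DiffOp.coef] using RingQuot.mkAlgHom_rel k (DiffOp.Rel.mul (δ := δ) a b))

@[simp] theorem DiffOp.coefHom_apply (δ : CommDeriv k A ι) (a : A) :
    DiffOp.coefHom δ a = DiffOp.coef δ a := rfl

theorem DiffOp.del_mul_coef (δ : CommDeriv k A ι) (i : ι) (a : A) :
    DiffOp.del δ i * DiffOp.coef δ a =
      DiffOp.coef δ a * DiffOp.del δ i + DiffOp.coef δ (δ.d i a) := by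
  simpa [DiffOp.coef, DiffOp.del] using
    RingQuot.mkAlgHom_rel k (DiffOp.Rel.leibniz (δ := δ) i a)

variable (k) (p : ℕ)

theorem Weyl.dt_comm (i j : Fin p) :
    Weyl.dt k p i * Weyl.dt k p j = Weyl.dt k p j * Weyl.dt k p i := by
  simpa [Weyl.dt] using RingQuot.mkAlgHom_rel k (Weyl.Rel.dd (k := k) i j)

theorem Weyl.dt_mul_t (i j : Fin p) :
    Weyl.dt k p i * Weyl.t k p j =
      Weyl.t k p j * Weyl.dt k p i + if i = j then 1 else 0 := by
  have h := RingQuot.mkAlgHom_rel k (Weyl.Rel.dt (k := k) i j)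
  simpa [Weyl.dt, Weyl.t, apply_ite] using h

/-- The constant coefficient operators `k[∂_t] → k[t]⟨∂_t⟩`. -/
noncomputable def Weyl.const : MvPolynomial (Fin p) k →ₐ[k] Weyl k p :=
  -- Polynomials can be evaluated only in a commutative algebra, so the evaluation takes place in
  -- the subalgebra generated by the commuting `∂_{t_j}` and is followed by the inclusion.
  let S := Algebra.adjoin k (Set.range (Weyl.dt k p))
  haveI := Algebra.isMulCommutative_adjoin k (s := Set.range (Weyl.dt k p)) (by
    rintro _ ⟨i, rfl⟩ _ ⟨j, rfl⟩
    exact Weyl.dt_comm k p i j)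
  letI : CommSemiring S := { S.toSemiring with mul_comm := mul_comm' }
  S.val.comp (MvPolynomial.aeval fun j => ⟨Weyl.dt k p j, Algebra.subset_adjoin ⟨j, rfl⟩⟩)

@[simp] theorem Weyl.const_X (j : Fin p) :
    Weyl.const k p (MvPolynomial.X j) = Weyl.dt k p j := by
  simp [Weyl.const]

/-- The commutator with `t_j` is a derivation on `k[∂_t]`, determined by its values on the variables
`∂_{t_l}`. This is what moves `t_j` to the right of a constant coefficient operator. -/
theorem Weyl.t_mul_const_add (j : Fin p) (q : MvPolynomial (Fin p) k) :
    Weyl.t k p j * Weyl.const k p q + Weyl.const k p (MvPolynomial.pderiv j q) =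
      Weyl.const k p q * Weyl.t k p j := by
  induction q using MvPolynomial.induction_on with
  | C a => simp [← MvPolynomial.algebraMap_eq, Algebra.commutes]
  | add a b ha hb =>
    simp only [map_add, mul_add, add_mul, ← ha, ← hb]
    exact add_add_add_comm _ _ _ _
  | mul_X a l ha =>
    have hl : MvPolynomial.pderiv j (a * MvPolynomial.X l) =
        MvPolynomial.pderiv j a * MvPolynomial.X l + a * if l = j then 1 else 0 := by
      rw [Derivation.leibniz, MvPolynomial.pderiv_X, smul_eq_mul, smul_eq_mul,
        Pi.single_apply, add_comm, mul_comm (MvPolynomial.X l)]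
    have hc : Weyl.const k p (if l = j then 1 else 0) = if l = j then 1 else 0 := by
      split_ifs <;> simp
    rw [hl, map_add, map_mul, map_mul, map_mul, hc, Weyl.const_X, ← add_assoc, ← mul_assoc,
      ← add_mul, ha, mul_assoc, mul_assoc, ← mul_add, Weyl.dt_mul_t]

variable {k} {p}

/-- The operator `∑_m a_m ∂_t^m`. -/
noncomputable def normalForm (δ : CommDeriv k A ι) (p : ℕ) :
    ((Fin p →₀ ℕ) →₀ A) →ₗ[k] DiffOpT δ p :=
  Finsupp.lsum k fun m =>
    (TensorProduct.mk k (DiffOp δ) (Weyl k p)).flip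
      (Weyl.const k p (MvPolynomial.monomial m 1)) ∘ₗ (DiffOp.coefHom δ).toLinearMap

theorem normalForm_single (δ : CommDeriv k A ι) (m : Fin p →₀ ℕ) (a : A) :
    normalForm δ p (Finsupp.single m a) =
      DiffOp.coef δ a ⊗ₜ Weyl.const k p (MvPolynomial.monomial m 1) := by
  rw [normalForm, Finsupp.lsum_single]
  rfl

theorem coef_tmul_const_mem_range (δ : CommDeriv k A ι) (a : A) (q : MvPolynomial (Fin p) k) :
    (DiffOp.coef δ a ⊗ₜ Weyl.const k p q : DiffOpT δ p) ∈ LinearMap.range (normalForm δ p) := by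
  induction q using MvPolynomial.induction_on' with
  | monomial m c =>
    refine ⟨Finsupp.single m (c • a), ?_⟩
    have h : MvPolynomial.monomial m c = c • MvPolynomial.monomial m (1 : k) := by
      simp [MvPolynomial.smul_monomial]
    rw [normalForm_single, h, map_smul, TensorProduct.tmul_smul, ← DiffOp.coefHom_apply,
      map_smul, TensorProduct.smul_tmul', DiffOp.coefHom_apply]
  | add u v hu hv =>
    rw [map_add, TensorProduct.tmul_add]
    exact add_mem hu hv

/-- The operators congruent to some `∑_m a_m ∂_t^m` modulo the left ideal generated by
`t_j - f_j` and `∂_i + ∑_j ∂_i(f_j) ∂_{t_j}`. -/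
noncomputable def reducible (δ : CommDeriv k A ι) (f : Fin p → A) : Submodule k (DiffOpT δ p) :=
  (Ideal.span (malgrangeGens δ f)).restrictScalars k ⊔ LinearMap.range (normalForm δ p)

theorem mem_reducible_of_mem_span {δ : CommDeriv k A ι} {f : Fin p → A} {x : DiffOpT δ p}
    (hx : x ∈ Ideal.span (malgrangeGens δ f)) : x ∈ reducible δ f :=
  Submodule.mem_sup_left (S := (Ideal.span (malgrangeGens δ f)).restrictScalars k) hx

theorem coef_tmul_const_mem_reducible (δ : CommDeriv k A ι) (f : Fin p → A) (a : A)
    (q : MvPolynomial (Fin p) k) :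
    (DiffOp.coef δ a ⊗ₜ Weyl.const k p q : DiffOpT δ p) ∈ reducible δ f :=
  Submodule.mem_sup_right (coef_tmul_const_mem_range δ a q)

/-- The ideal summand of `reducible` absorbs left multiplication by any `P`, so by additivity only
the products of `P` with the terms `a ∂_t^m` need testing. -/
theorem mul_mem_reducible {δ : CommDeriv k A ι} {f : Fin p → A} {P : DiffOpT δ p}
    (hP : ∀ a m, P * (DiffOp.coef δ a ⊗ₜ Weyl.const k p (MvPolynomial.monomial m 1)) ∈
      reducible δ f) {x : DiffOpT δ p} (hx : x ∈ reducible δ f) : P * x ∈ reducible δ f := by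
  obtain ⟨y, hy, _, ⟨c, rfl⟩, rfl⟩ := Submodule.mem_sup.mp hx
  rw [mul_add]
  refine add_mem (mem_reducible_of_mem_span (Ideal.mul_mem_left _ P hy)) ?_
  induction c using Finsupp.induction_linear with
  | zero => simp
  | add c d hc hd =>
    rw [map_add, mul_add]
    -- The membership of `y` plus the normal form depends on `c`, so it is a premise of each
    -- induction hypothesis and has to be supplied for each summand.
    exact add_mem (hc (add_mem (mem_reducible_of_mem_span hy) (Submodule.mem_sup_right ⟨c, rfl⟩)))
      (hd (add_mem (mem_reducible_of_mem_span hy) (Submodule.mem_sup_right ⟨d, rfl⟩)))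
  | single m a => rw [normalForm_single]; exact hP a m

theorem coef_mul_mem_reducible {δ : CommDeriv k A ι} {f : Fin p → A} (b : A) {x : DiffOpT δ p}
    (hx : x ∈ reducible δ f) : (DiffOp.coef δ b ⊗ₜ 1 : DiffOpT δ p) * x ∈ reducible δ f := by
  refine mul_mem_reducible (fun a m => ?_) hx
  rw [Algebra.TensorProduct.tmul_mul_tmul, one_mul, ← DiffOp.coefHom_apply,
    ← DiffOp.coefHom_apply, ← map_mul]
  exact coef_tmul_const_mem_reducible δ f _ _

theorem dt_mul_mem_reducible {δ : CommDeriv k A ι} {f : Fin p → A} (j : Fin p) {x : DiffOpT δ p}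
    (hx : x ∈ reducible δ f) : (1 ⊗ₜ Weyl.dt k p j : DiffOpT δ p) * x ∈ reducible δ f := by
  refine mul_mem_reducible (fun a m => ?_) hx
  rw [Algebra.TensorProduct.tmul_mul_tmul, one_mul, ← Weyl.const_X, ← map_mul]
  exact coef_tmul_const_mem_reducible δ f _ _

/-- Commuting `t_j` past `q(∂_t)` costs a term with the derivative of `q`, again in normal form.
Once on the right, `t_j` becomes `f_j` modulo the ideal, and `f_j` commutes with `∂_t`. -/
theorem t_mul_mem_reducible {δ : CommDeriv k A ι} {f : Fin p → A} (j : Fin p) {x : DiffOpT δ p}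
    (hx : x ∈ reducible δ f) : (1 ⊗ₜ Weyl.t k p j : DiffOpT δ p) * x ∈ reducible δ f := by
  refine mul_mem_reducible (fun a m => ?_) hx
  set q : MvPolynomial (Fin p) k := MvPolynomial.monomial m 1
  obtain ⟨g, hg, hgt⟩ : ∃ g ∈ malgrangeGens δ f,
      g + DiffOp.coef δ (f j) ⊗ₜ 1 = (1 ⊗ₜ Weyl.t k p j : DiffOpT δ p) :=
    ⟨_, Or.inl ⟨j, rfl⟩, sub_add_cancel _ _⟩
  have h : (1 ⊗ₜ Weyl.t k p j : DiffOpT δ p) * (DiffOp.coef δ a ⊗ₜ Weyl.const k p q) +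
      DiffOp.coef δ a ⊗ₜ Weyl.const k p (MvPolynomial.pderiv j q) =
      (DiffOp.coef δ a ⊗ₜ Weyl.const k p q) * g +
        DiffOp.coef δ (a * f j) ⊗ₜ Weyl.const k p q := by
    have hm : DiffOp.coef δ (a * f j) = DiffOp.coef δ a * DiffOp.coef δ (f j) :=
      map_mul (DiffOp.coefHom δ) _ _
    have e : (DiffOp.coef δ a ⊗ₜ Weyl.const k p q : DiffOpT δ p) *
        (DiffOp.coef δ (f j) ⊗ₜ 1) = DiffOp.coef δ (a * f j) ⊗ₜ Weyl.const k p q := by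
      rw [Algebra.TensorProduct.tmul_mul_tmul, mul_one, hm]
    rw [← e, ← mul_add, hgt, Algebra.TensorProduct.tmul_mul_tmul,
      Algebra.TensorProduct.tmul_mul_tmul, one_mul, mul_one, ← TensorProduct.tmul_add,
      Weyl.t_mul_const_add]
  refine mem_of_add_mem (coef_tmul_const_mem_reducible δ f _ _) (h ▸ add_mem
    (mem_reducible_of_mem_span (Ideal.mul_mem_left _ _ (Ideal.subset_span hg))) ?_)
  exact coef_tmul_const_mem_reducible δ f _ _

/-- By the Leibniz rule `∂_i` moves to the right of `a q(∂_t)` at the cost of `δ_i(a) q(∂_t)`. There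
it is traded for `-∑_j δ_i(f_j) ∂_{t_j}`, which only multiplies `a` by elements of `A` and `q` by
variables. -/
theorem del_mul_mem_reducible {δ : CommDeriv k A ι} {f : Fin p → A} (i : ι) {x : DiffOpT δ p}
    (hx : x ∈ reducible δ f) : (DiffOp.del δ i ⊗ₜ 1 : DiffOpT δ p) * x ∈ reducible δ f := by
  refine mul_mem_reducible (fun a m => ?_) hx
  set q : MvPolynomial (Fin p) k := MvPolynomial.monomial m 1
  have h : (DiffOp.del δ i ⊗ₜ 1 : DiffOpT δ p) * (DiffOp.coef δ a ⊗ₜ Weyl.const k p q) +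
      ∑ j, DiffOp.coef δ (a * δ.d i (f j)) ⊗ₜ Weyl.const k p (q * MvPolynomial.X j) =
      (DiffOp.coef δ a ⊗ₜ Weyl.const k p q) * (DiffOp.del δ i ⊗ₜ[k] 1 +
        ∑ j : Fin p, DiffOp.coef δ (δ.d i (f j)) ⊗ₜ[k] Weyl.dt k p j) +
      DiffOp.coef δ (δ.d i a) ⊗ₜ Weyl.const k p q := by
    have hm : ∀ b, DiffOp.coef δ (a * b) = DiffOp.coef δ a * DiffOp.coef δ b :=
      map_mul (DiffOp.coefHom δ) _
    simp only [mul_add, Finset.mul_sum, Algebra.TensorProduct.tmul_mul_tmul, one_mul, mul_one,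
      DiffOp.del_mul_coef, TensorProduct.add_tmul, hm, map_mul, Weyl.const_X]
    exact add_right_comm _ _ _
  refine mem_of_add_mem (sum_mem fun j _ => ?_) (h ▸ add_mem (mem_reducible_of_mem_span
    (Ideal.mul_mem_left _ _ (Ideal.subset_span (Or.inr ⟨i, rfl⟩)))) ?_) <;>
  exact coef_tmul_const_mem_reducible δ f _ _

/-- The operators whose left multiplication preserves `reducible` form a subalgebra. It contains the
generators of both tensor factors, hence everything, and applying it to `1 ∈ reducible` gives the
claim. -/
theorem reducible_eq_top (δ : CommDeriv k A ι) (f : Fin p → A) : reducible δ f = ⊤ := by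
  let S : Subalgebra k (DiffOpT δ p) :=
    { carrier := {P | ∀ x ∈ reducible δ f, P * x ∈ reducible δ f}
      mul_mem' := fun {P Q} hP hQ x hx => by rw [mul_assoc]; exact hP _ (hQ x hx)
      add_mem' := fun {P Q} hP hQ x hx => by rw [add_mul]; exact add_mem (hP x hx) (hQ x hx)
      algebraMap_mem' := fun r x hx => by
        rw [← Algebra.smul_def]; exact Submodule.smul_mem _ r hx }
  have hD : ∀ z : DiffOp δ, (z ⊗ₜ 1 : DiffOpT δ p) ∈ S := by
    refine map_mem_of_generators (Algebra.TensorProduct.includeLeft : DiffOp δ →ₐ[k] DiffOpT δ p) S ?_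
    rintro (a | i)
    · exact fun x hx => coef_mul_mem_reducible a hx
    · exact fun x hx => del_mul_mem_reducible i hx
  have hW : ∀ z : Weyl k p, (1 ⊗ₜ z : DiffOpT δ p) ∈ S := by
    refine map_mem_of_generators (Algebra.TensorProduct.includeRight : Weyl k p →ₐ[k] DiffOpT δ p) S ?_
    rintro (j | j)
    · exact fun x hx => t_mul_mem_reducible j hx
    · exact fun x hx => dt_mul_mem_reducible j hx
  have h1 : (1 : DiffOpT δ p) ∈ reducible δ f := by
    have := coef_tmul_const_mem_reducible δ f 1 (1 : MvPolynomial (Fin p) k)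
    rwa [← DiffOp.coefHom_apply, map_one, map_one] at this
  refine Submodule.eq_top_iff'.mpr fun P => ?_
  have hP : P ∈ S := by
    induction P using TensorProduct.induction_on with
    | zero => exact zero_mem S
    | tmul x y =>
      have := S.mul_mem (hD x) (hW y)
      rwa [Algebra.TensorProduct.tmul_mul_tmul, one_mul, mul_one] at this
    | add x y hx hy => exact add_mem hx hy
  simpa using hP 1 h1

end NormalForm

/-! ### Normal forms acting on `f^s` -/

section Annihilator

variable {k A ι : Type*} [CommRing k] [CommRing A] [Algebra k A] {p : ℕ}

theorem act_tmul (δ : CommDeriv k A ι) (f : Fin p → A) (x : DiffOp δ) (y : Weyl k p) :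
    act δ f (x ⊗ₜ y) = actD δ f x * actW k f y := by
  simp [act]

theorem span_malgrangeGens_le_annFs (δ : CommDeriv k A ι) (f : Fin p → A) :
    Ideal.span (malgrangeGens δ f) ≤ annFs δ f := by
  rw [Ideal.span_le]
  rintro _ (⟨j, rfl⟩ | ⟨i, rfl⟩) <;> change act δ f _ (1 : LMod f) = 0
  · simp [act_tmul, actW_t, actD_coef, opT_apply, opCoef_apply]
  -- Since `∂_{t_j} · f^s = -s_j f_j⁻¹ f^s`, the sum over `j` cancels the logarithmic derivative
  -- `∂_i · f^s` term by term.
  · simp [act_tmul, actW_dt, actD_coef, actD_del, opDt_apply, opCoef_apply, opDel_apply, logDer,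
      LinearMap.sum_apply, ← Finset.sum_add_distrib]
    exact Finset.sum_eq_zero fun j _ => by ring

theorem eval_shift {B : Type*} [CommRing B] (j : Fin p) (c : ℤ) (r : Fin p → B)
    (g : MvPolynomial (Fin p) B) :
    MvPolynomial.eval r (shift j c g) =
      MvPolynomial.eval (fun l => r l + if l = j then (c : B) else 0) g := by
  induction g using MvPolynomial.induction_on with
  | C b => simp
  | add a b ha hb => simp [ha, hb]
  | mul_X a l ha =>
    rw [map_mul, map_mul, ha, map_mul, shift_X, MvPolynomial.eval_X]
    congr 1
    split_ifs <;> simp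

variable (k) in
/-- The value at `s = r` of the coefficient of `f^s` in `∂_t^m · f^s`. -/
noncomputable def dtValue (f : Fin p → A) (m r : Fin p →₀ ℕ) : InvF f :=
  MvPolynomial.eval (fun l => (r l : InvF f))
    (actW k f (Weyl.const k p (MvPolynomial.monomial m 1)) 1)

theorem dtValue_zero (f : Fin p → A) (r : Fin p →₀ ℕ) : dtValue k f 0 r = 1 := by
  have : (MvPolynomial.monomial 0 1 : MvPolynomial (Fin p) k) = 1 := rfl
  simp [dtValue, this]

theorem const_monomial_add_single (m : Fin p →₀ ℕ) (j : Fin p) :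
    Weyl.const k p (MvPolynomial.monomial (m + Finsupp.single j 1) 1) =
      Weyl.dt k p j * Weyl.const k p (MvPolynomial.monomial m 1) := by
  rw [← Weyl.const_X, ← map_mul, mul_comm, MvPolynomial.X, MvPolynomial.monomial_mul, one_mul]

/-- The shift `s_j ↦ s_j - 1` in the action of `∂_{t_j}` brings the evaluation point back to `r`,
while its factor `s_j` takes the value `r_j + 1`. This recursion replaces the closed formula with
falling factorials. -/
theorem dtValue_add_single (f : Fin p → A) (m r : Fin p →₀ ℕ) (j : Fin p) :
    dtValue k f (m + Finsupp.single j 1) (r + Finsupp.single j 1) =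
      - (((r j + 1 : ℕ) : InvF f) * (dtValue k f m r * finv f j)) := by
  have h : (fun l => ((r + Finsupp.single j 1 : Fin p →₀ ℕ) l : InvF f) +
      if l = j then ((-1 : ℤ) : InvF f) else 0) = fun l => (r l : InvF f) := by
    funext l
    by_cases hl : l = j
    · subst hl; simp
    · simp [hl]
  rw [dtValue, const_monomial_add_single, map_mul, Module.End.mul_apply, actW_dt, opDt_apply]
  rw [map_neg, map_mul, map_mul, eval_shift, h]
  simp [dtValue]

/-- The last `∂_{t_j}` applied contributes a factor `s_j`, which is zero at the evaluation point. -/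
theorem dtValue_add_single_of_eq_zero (f : Fin p → A) (m r : Fin p →₀ ℕ) (j : Fin p)
    (hr : r j = 0) : dtValue k f (m + Finsupp.single j 1) r = 0 := by
  rw [dtValue, const_monomial_add_single, map_mul, Module.End.mul_apply, actW_dt, opDt_apply]
  simp [hr]

theorem exists_eq_add_single {m : Fin p →₀ ℕ} {j : Fin p} (h : m j ≠ 0) :
    ∃ m' : Fin p →₀ ℕ, m = m' + Finsupp.single j 1 :=
  ⟨m - Finsupp.single j 1, (tsub_add_cancel_of_le (by
    simpa [Nat.one_le_iff_ne_zero] using h)).symm⟩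

/-- The falling factorial `s_j (s_j - 1) ⋯ (s_j - m_j + 1)` vanishes at `s_j = r_j` as soon as `r_j
< m_j`. -/
theorem dtValue_eq_zero (f : Fin p → A) (m r : Fin p →₀ ℕ) (h : ¬ m ≤ r) :
    dtValue k f m r = 0 := by
  induction hd : m.degree generalizing m r with
  | zero => simp [(Finsupp.degree_eq_zero_iff m).mp hd] at h
  | succ d ih =>
    have hm : m ≠ 0 := by rintro rfl; simp at hd
    obtain ⟨j, hj⟩ := Finsupp.ne_iff.mp hm
    obtain ⟨m, rfl⟩ := exists_eq_add_single hj
    -- If `r_j > 0`, lowering both `m_j` and `r_j` by one preserves the failure of `m ≤ r`.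
    by_cases hr : r j = 0
    · exact dtValue_add_single_of_eq_zero f m r j hr
    obtain ⟨r, rfl⟩ := exists_eq_add_single hr
    rw [dtValue_add_single, ih m r (fun h' => h (add_le_add_left h' _)) (by simpa using hd)]
    simp

/-- The value is the product of the `(-1)^{m_j} m_j! f_j^{-m_j}`, and factorials are invertible in
characteristic zero. -/
theorem isUnit_dtValue_self {k : Type*} [Field k] [CharZero k] [Algebra k A] (f : Fin p → A)
    (m : Fin p →₀ ℕ) : IsUnit (dtValue k f m m) := by
  induction hd : m.degree generalizing m with
  | zero => rw [(Finsupp.degree_eq_zero_iff m).mp hd, dtValue_zero]; exact isUnit_one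
  | succ d ih =>
    have hm : m ≠ 0 := by rintro rfl; simp at hd
    obtain ⟨j, hj⟩ := Finsupp.ne_iff.mp hm
    obtain ⟨m, rfl⟩ := exists_eq_add_single hj
    rw [dtValue_add_single, IsUnit.neg_iff]
    refine IsUnit.mul ?_ ((ih m (by simpa using hd)).mul ?_)
    · have : IsUnit ((m j + 1 : ℕ) : k) := (Nat.cast_ne_zero.mpr (Nat.succ_ne_zero _)).isUnit
      simpa only [map_natCast] using this.map (algebraMap k (InvF f))
    · exact .of_mul_eq_one_right _ (mul_finv f j)

theorem eval_act_normalForm (δ : CommDeriv k A ι) (f : Fin p → A) (c : (Fin p →₀ ℕ) →₀ A)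
    (r : Fin p →₀ ℕ) :
    MvPolynomial.eval (fun l => (r l : InvF f)) (act δ f (normalForm δ p c) 1) =
      ∑ m ∈ c.support, algebraMap A (InvF f) (c m) * dtValue k f m r := by
  change _ = c.sum fun m a => algebraMap A (InvF f) a * dtValue k f m r
  induction c using Finsupp.induction_linear with
  | zero => simp
  | add c d hc hd =>
    rw [Finsupp.sum_add_index' (by simp) (by simp [add_mul]), ← hc, ← hd]
    simp
  | single m a =>
    rw [Finsupp.sum_single_index (by simp), normalForm_single, act_tmul, actD_coef,
      Module.End.mul_apply, opCoef_apply, map_mul, MvPolynomial.eval_C, dtValue]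

/-- For a minimal `m` in the support, evaluation at `s = m` removes every other term by
triangularity and leaves `c m` times a unit. Injectivity of `A → A[1/F]` then gives `c m = 0`, a
contradiction. -/
theorem eq_zero_of_act_normalForm_eq_zero {k : Type*} [Field k] [CharZero k] [Algebra k A]
    (δ : CommDeriv k A ι) (f : Fin p → A)
    (hf : Function.Injective (algebraMap A (InvF f))) (c : (Fin p →₀ ℕ) →₀ A)
    (hc : act δ f (normalForm δ p c) 1 = 0) : c = 0 := by
  by_contra hne
  obtain ⟨m, hm⟩ := c.support.exists_minimal (Finsupp.support_nonempty_iff.mpr hne)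
  have h := eval_act_normalForm δ f c m
  rw [hc, map_zero, Finset.sum_eq_single_of_mem m hm.prop] at h
  · have h0 := (isUnit_dtValue_self (k := k) f m).mul_left_eq_zero.mp h.symm
    exact Finsupp.mem_support_iff.mp hm.prop (hf (h0.trans (map_zero _).symm))
  · intro m' hm' hne'
    rw [dtValue_eq_zero f m' m fun hle => hne' (hm.eq_of_le hm' hle), mul_zero]

/-- The annihilator of `f^s` over any ring `A` in which `f_1 ⋯ f_p` is not a zero divisor. -/
theorem annFs_eq_span_malgrangeGens {k : Type*} [Field k] [CharZero k] [Algebra k A]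
    (δ : CommDeriv k A ι) (f : Fin p → A) (hf : ∏ j, f j ∈ nonZeroDivisors A) :
    annFs δ f = Ideal.span (malgrangeGens δ f) := by
  refine le_antisymm (fun P hP => ?_) (span_malgrangeGens_le_annFs δ f)
  have hinj : Function.Injective (algebraMap A (InvF f)) :=
    IsLocalization.injective _ (Submonoid.powers_le.mpr hf)
  have hmem : P ∈ reducible δ f := reducible_eq_top δ f ▸ Submodule.mem_top
  obtain ⟨y, hy, _, ⟨c, rfl⟩, rfl⟩ := Submodule.mem_sup.mp hmem
  -- The ideal part `y` of `P` already kills `f^s`, so the normal form part does too.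
  have hc : normalForm δ p c ∈ annFs δ f := by
    have hy' : act δ f y 1 = 0 := span_malgrangeGens_le_annFs δ f hy
    have hP' : act δ f (y + normalForm δ p c) 1 = 0 := hP
    rwa [map_add, LinearMap.add_apply, hy', zero_add] at hP'
  rw [eq_zero_of_act_normalForm_eq_zero δ f hinj c hc, map_zero, add_zero]
  exact hy

end Annihilator

end BernsteinSato
-- Nonvanishing of `F` in the coefficient rings
namespace BernsteinSato

/-- Expansion at `a` is the translation `x ↦ x + a`, inverted by `x ↦ x - a`, followed by the
inclusion of polynomials into power series. -/
theorem expandAt_injective {k : Type*} [Field k] {n : ℕ} (a : Fin n → k) :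
    Function.Injective (expandAt a) := by
  let T (b : Fin n → k) : MvPolynomial (Fin n) k →ₐ[k] MvPolynomial (Fin n) k :=
    MvPolynomial.aeval fun i => MvPolynomial.X i + MvPolynomial.C (b i)
  have hT : (T (-a)).comp (T a) = AlgHom.id k _ := by
    ext i : 1
    simp [T, MvPolynomial.algHom_C]
  have hE : expandAt a = (MvPolynomial.coeToMvPowerSeries.algHom k).comp (T a) := by
    ext i : 1
    simp [T, expandAt]
  have hTa : Function.Injective (T a) :=
    Function.LeftInverse.injective (g := T (-a)) fun q => DFunLike.congr_fun hT q
  rw [hE]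
  exact (MvPolynomial.coe_injective (Fin n) k).comp hTa

/-- On a ball where both functions are analytic and `g h = 0`, a point `w` with `g w ≠ 0` has a
neighbourhood on which `h` vanishes. The identity theorem spreads this to the whole ball, which is
connected. -/
theorem analyticGerms_noZeroDivisors {n : ℕ} (a : Fin n → ℂ) :
    NoZeroDivisors (analyticGerms a) where
  eq_zero_or_eq_zero_of_mul_eq_zero := by
    rintro ⟨_, g, hg, rfl⟩ ⟨_, h, hh, rfl⟩ hgh
    have hgh' : ∀ᶠ z in 𝓝 a, g z * h z = 0 := Germ.coe_eq.mp (congrArg Subtype.val hgh)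
    by_contra! hne
    have hg0 : ¬ ∀ᶠ z in 𝓝 a, g z = 0 := fun h0 => hne.1 (Subtype.ext (Germ.coe_eq.mpr h0))
    have hh0 : ¬ ∀ᶠ z in 𝓝 a, h z = 0 := fun h0 => hne.2 (Subtype.ext (Germ.coe_eq.mpr h0))
    obtain ⟨ε, hε, hball⟩ := Metric.eventually_nhds_iff_ball.mp
      (hgh'.and (hg.eventually_analyticAt.and hh.eventually_analyticAt))
    obtain ⟨w, hw, hgw⟩ : ∃ w ∈ Metric.ball a ε, g w ≠ 0 := by
      by_contra! h0
      exact hg0 (Metric.eventually_nhds_iff_ball.mpr ⟨ε, hε, h0⟩)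
    have hhw : h =ᶠ[𝓝 w] 0 := by
      filter_upwards [(hball w hw).2.1.continuousAt.eventually_ne hgw,
        Metric.isOpen_ball.mem_nhds hw] with z hz hzb
      exact (mul_eq_zero.mp (hball z hzb).1).resolve_left hz
    have han : AnalyticOnNhd ℂ h (Metric.ball a ε) := fun z hz => (hball z hz).2.2
    exact hh0 (Metric.eventually_nhds_iff_ball.mpr ⟨ε, hε,
      han.eqOn_zero_of_preconnected_of_eventuallyEq_zero
        (convex_ball a ε).isPreconnected hw hhw⟩)

/-- A polynomial function vanishing near `a` vanishes on all of `ℂⁿ` by the identity theorem, and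
over an infinite field it is then the zero polynomial. -/
theorem polyGerm_ne_zero {n : ℕ} (a : Fin n → ℂ) {q : MvPolynomial (Fin n) ℂ} (hq : q ≠ 0) :
    polyGerm a q ≠ 0 := by
  intro h
  have h0 : (fun z => MvPolynomial.eval z q) =ᶠ[𝓝 a] 0 :=
    Germ.coe_eq.mp (congrArg Subtype.val h)
  have := (AnalyticOnNhd.eval_mvPolynomial q).eqOn_zero_of_preconnected_of_eventuallyEq_zero
    isPreconnected_univ (Set.mem_univ a) h0
  exact hq (MvPolynomial.funext fun z => by simpa using this (Set.mem_univ z))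

end BernsteinSato

theorem lemma1p1 {n p : ℕ} :
    (∀ (k : Type*) [Field k] [CharZero k] (a : Fin n → k)
      (f : Fin p → MvPolynomial (Fin n) k), (∀ j, f j ≠ 0) →
      (BernsteinSato.annFs (BernsteinSato.formalDeriv k n)
          (fun j => BernsteinSato.expandAt a (f j)) =
        Ideal.span (BernsteinSato.malgrangeGens (BernsteinSato.formalDeriv k n)
          (fun j => BernsteinSato.expandAt a (f j)))) ∧
      (BernsteinSato.annFs (BernsteinSato.localDeriv a)
          (fun j => algebraMap _ (BernsteinSato.LocalRingAt a) (f j)) =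
        Ideal.span (BernsteinSato.malgrangeGens (BernsteinSato.localDeriv a)
          (fun j => algebraMap _ (BernsteinSato.LocalRingAt a) (f j)))) ∧
      (BernsteinSato.annFs (BernsteinSato.polyDeriv k n) f =
        Ideal.span (BernsteinSato.malgrangeGens (BernsteinSato.polyDeriv k n) f))) ∧
    (∀ (a : Fin n → ℂ) (f : Fin p → MvPolynomial (Fin n) ℂ), (∀ j, f j ≠ 0) →
      BernsteinSato.annFs (BernsteinSato.analyticDeriv a)
          (fun j => BernsteinSato.polyGerm a (f j)) =
        Ideal.span (BernsteinSato.malgrangeGens (BernsteinSato.analyticDeriv a)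
          (fun j => BernsteinSato.polyGerm a (f j)))) := by
  -- In each ring it suffices that the product of the `f_j` is not a zero divisor; this holds factor
  -- by factor.
  refine ⟨fun k _ _ a f hf => ⟨?_, ?_, ?_⟩, fun a f hf => ?_⟩ <;>
    refine BernsteinSato.annFs_eq_span_malgrangeGens _ _ ?_
  · exact prod_mem fun j _ => mem_nonZeroDivisors_of_ne_zero
      ((map_ne_zero_iff _ (BernsteinSato.expandAt_injective a)).mpr (hf j))
  · have hle : (BernsteinSato.maxIdealAt a).primeCompl ≤ nonZeroDivisors _ :=
      Ideal.primeCompl_le_nonZeroDivisors _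
    have : IsDomain (BernsteinSato.LocalRingAt a) := IsLocalization.isDomain_localization hle
    exact prod_mem fun j _ => mem_nonZeroDivisors_of_ne_zero
      ((map_ne_zero_iff _ (IsLocalization.injective _ hle)).mpr (hf j))
  · exact prod_mem fun j _ => mem_nonZeroDivisors_of_ne_zero (hf j)
  · have := BernsteinSato.analyticGerms_noZeroDivisors a
    exact prod_mem fun j _ => mem_nonZeroDivisors_of_ne_zero
      (BernsteinSato.polyGerm_ne_zero a (hf j))
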